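/- Fix a set $X$ of propositional variables; an assignment is a map $X\to\{0,1\}$. An NNF is a finite directed acyclic graph with a unique sink (the output gate) whose sources are labeled by constants $0,1$ or literals $x,\neg x$ ($x\in X$) and whose other nodes are labeled by $\wedge$ or $\vee$. Its size is its number of arcs (wires), its value under an assignment is defined inductively as usual, and two NNFs are equivalent if they have the same value under every assignment. For a gate $v$, the variables below $v$ are those labeling sources from which there is a (possibly trivial) directed path to $v$. A DNNF is an NNF in which, for every $\wedge$-gate, the sets of variables below any two distinct gates with a wire into it are disjoint. For an NNF $C$ let $\mathsf{DNNF}(C)$ be the minimum size of a DNNF equivalent to $C$. Let $d\ge 3$ be an integer and $c>0$ a real number. A finite simple graph $G=(V,E)$ is a $(c,d)$-expander if its maximum degree is $d$ and every $S\subseteq V$ with $|S|\le |V|/2$ satisfies $|\{v\in V\setminus S:\ \{u,v\}\in E \text{ for some } u\in S\}|\ge c|S|$. For a graph $G=(V,E)$ with $V\subseteq X$, the edge set $E$ is identified with the graph CNF $\bigwedge_{\{x,y\}\in E}(x\vee y)$, viewed as an NNF: an $\wedge$-gate as output, with one wire from an $\vee$-gate for each edge, each of which has one wire from each of its two variables.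 **Theorem.** Let $G=(V,E)$ be a $(c,d)$-expander with $|V|\ge 2$. Then $$\mathsf{DNNF}(E)\ \ge\ 2^{\,g(c,d)\cdot\mathsf{size}(E)-1},\qquad\text{where } g(c,d)=\frac{c\cdot\log_2(1+2^{-d})}{6d^3}.$$ -/

import Mathlib

universe u

/-! ### Boolean circuits in negation normal form -/

/-- Labels of the gates of a circuit over the variable set `X`: a constant, a literal
(`lit x true` is the literal `x`, `lit x false` is the literal `¬ x`), `∧` or `∨`. -/
inductive GateLabel (X : Type*) where
  | const (b : Bool)
  | lit (x : X) (b : Bool)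
  | and
  | or

/-- Labels that are allowed on input gates: constants and literals. -/
def GateLabel.IsInput {X : Type*} : GateLabel X → Prop
  | .const _ => True
  | .lit _ _ => True
  | .and => False
  | .or => False

/-- A circuit in negation normal form over the variable set `X`: a finite labeled DAG with a
unique sink (the output gate), whose sources (the input gates) are labeled by constants or
literals and whose other gates are labeled by `∧` or `∨`. `wire u v` is an arc from `u` to `v`. -/
structure NNF (X : Type u) where
  Gate : Type u
  finite : Finite Gate
  wire : Gate → Gate → Prop
  acyclic : ∀ v, ¬ Relation.TransGen wire v v
  label : Gate → GateLabel X
  out : Gate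
  isSink_iff : ∀ v, (∀ w, ¬ wire v w) ↔ v = out
  isInput_iff : ∀ v, (label v).IsInput ↔ ∀ u, ¬ wire u v

namespace NNF

variable {X : Type u}

theorem wellFounded (C : NNF X) : WellFounded C.wire := by
  have := C.finite
  have : IsTrans C.Gate (Relation.TransGen C.wire) := ⟨fun _ _ _ => Relation.TransGen.trans⟩
  have : Std.Irrefl (Relation.TransGen C.wire) := ⟨C.acyclic⟩
  exact Subrelation.wf (fun h => Relation.TransGen.single h)
    (Finite.wellFounded_of_trans_of_irrefl (Relation.TransGen C.wire))

/-- `C.SatAt f v`: the subcircuit of `C` sinked at `v` has value `1` under the assignment `f`. -/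
def SatAt (C : NNF X) (f : X → Bool) : C.Gate → Prop :=
  C.wellFounded.fix fun v ih =>
    match C.label v with
    | .const b => b = true
    | .lit x b => f x = b
    | .and => ∀ u, ∀ h : C.wire u v, ih u h
    | .or => ∃ u, ∃ h : C.wire u v, ih u h

theorem satAt_iff (C : NNF X) (f : X → Bool) (v : C.Gate) :
    C.SatAt f v ↔
      match C.label v with
      | .const b => b = true
      | .lit x b => f x = b
      | .and => ∀ u, C.wire u v → C.SatAt f u
      | .or => ∃ u, C.wire u v ∧ C.SatAt f u := by
  rw [SatAt, WellFounded.fix_eq]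
  cases C.label v <;> simp

/-- `f` is a satisfying assignment of `C`. -/
def Sat (C : NNF X) (f : X → Bool) : Prop := C.SatAt f C.out

/-- Two circuits are equivalent if they have the same value under all assignments. -/
def Equivalent (C D : NNF X) : Prop := ∀ f : X → Bool, C.Sat f ↔ D.Sat f

/-- The variables of the subcircuit of `C` sinked at `v`. -/
def varsAt (C : NNF X) (v : C.Gate) : Set X :=
  {x | ∃ u b, Relation.ReflTransGen C.wire u v ∧ C.label u = .lit x b}

/-- The size of a circuit is its number of wires. -/
noncomputable def size (C : NNF X) : ℕ := {p : C.Gate × C.Gate | C.wire p.1 p.2}.ncard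

/-- An NNF is a DNNF if distinct gates with wires into the same `∧`-gate sink subcircuits with
disjoint sets of variables. -/
def IsDecomposable (C : NNF X) : Prop :=
  ∀ v, C.label v = .and → ∀ u u', C.wire u v → C.wire u' v → u ≠ u' →
    Disjoint (C.varsAt u) (C.varsAt u')

/-- The size of the smallest DNNF equivalent to `C`. -/
noncomputable def dnnfSize (C : NNF X) : ℕ :=
  sInf {s | ∃ D : NNF X, D.IsDecomposable ∧ D.Equivalent C ∧ D.size = s}

end NNF

/-! ### Graph CNFs -/

section GraphCNF

variable {X : Type u} {V : Finset X}

/-- The gates of the graph CNF of `G`: the output gate, a gate for each edge (clause),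
and an input gate for each non-isolated vertex (variable). -/
inductive GraphCNFGate (G : SimpleGraph V) : Type u where
  | out
  | clause (e : G.edgeSet)
  | var (x : G.support)

/-- The wires of the graph CNF of `G`: from each clause to the output gate, and from both
endpoints of each edge to the clause of that edge. -/
inductive GraphCNFWire (G : SimpleGraph V) : GraphCNFGate G → GraphCNFGate G → Prop where
  | toOut (e : G.edgeSet) : GraphCNFWire G (.clause e) .out
  | toClause (x : G.support) (e : G.edgeSet) (h : (x : V) ∈ (e : Sym2 V)) :
      GraphCNFWire G (.var x) (.clause e)

open Classical in
/-- The output gate is an `∧`-gate (the constant `1`, the empty conjunction, if there is no edge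
at all), the clauses are `∨`-gates, and the input gate of a vertex `x` has label `x`. -/
noncomputable def graphCNFLabel (G : SimpleGraph V) : GraphCNFGate G → GateLabel X
  | .out => if G = ⊥ then .const true else .and
  | .clause _ => .or
  | .var x => .lit ((x : V) : X) true

/-- The graph CNF `⋀_{{x, y} ∈ E} (x ∨ y)` of a graph `G = (V, E)` whose vertices are variables,
as a circuit. -/
noncomputable abbrev graphCNF (G : SimpleGraph V) : NNF X where
  Gate := GraphCNFGate G
  finite := by
    let F : GraphCNFGate G → Option (G.edgeSet ⊕ G.support) := fun
      | .out => none
      | .clause e => some (.inl e)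
      | .var x => some (.inr x)
    refine Finite.of_injective F ?_
    intro a b h
    cases a <;> cases b <;> simp_all [F]
  wire := GraphCNFWire G
  acyclic := by
    let r : GraphCNFGate G → ℕ := fun
      | .out => 2
      | .clause _ => 1
      | .var _ => 0
    have key : ∀ a b, Relation.TransGen (GraphCNFWire G) a b → r a < r b := by
      intro a b h
      induction h with
      | single h => cases h <;> simp [r]
      | tail _ h ih => exact ih.trans (by cases h <;> simp [r])
    exact fun v h => lt_irrefl _ (key v v h)
  label := graphCNFLabel G
  out := .out
  isSink_iff := by
    intro v
    constructor
    · intro h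
      cases v with
      | out => rfl
      | clause e => exact absurd (GraphCNFWire.toOut e) (h _)
      | var x =>
        obtain ⟨x, y, hxy⟩ := x
        exact absurd (GraphCNFWire.toClause ⟨x, y, hxy⟩ ⟨s(x, y), hxy⟩ (by simp)) (h _)
    · rintro rfl w h
      cases h
  isInput_iff := by
    intro v
    cases v with
    | out =>
      by_cases hG : G = ⊥
      · simp only [graphCNFLabel, hG, if_true, GateLabel.IsInput, true_iff]
        intro u hu
        cases hu with
        | toOut e => exact by subst hG; simpa using e.2
      · simp only [graphCNFLabel, hG, if_false, GateLabel.IsInput, false_iff]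
        intro h
        apply hG
        rw [← SimpleGraph.edgeSet_eq_empty]
        exact Set.eq_empty_iff_forall_notMem.2 fun e he => h _ (GraphCNFWire.toOut ⟨e, he⟩)
    | clause e =>
      simp only [graphCNFLabel, GateLabel.IsInput, false_iff]
      intro h
      obtain ⟨e, he⟩ := e
      induction e using Sym2.ind with
      | _ x y => exact h _ (GraphCNFWire.toClause ⟨x, y, he⟩ ⟨s(x, y), he⟩ (by simp))
    | var x =>
      simp only [graphCNFLabel, GateLabel.IsInput, true_iff]
      intro u hu
      cases hu

end GraphCNF

/-! ### Expanders -/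

/-- The open neighbourhood of a set `S` of vertices: the vertices outside `S` with a neighbour
in `S`. -/
def openNeighborhood {V : Type*} (G : SimpleGraph V) (S : Set V) : Set V :=
  {v | v ∉ S ∧ ∃ u ∈ S, G.Adj u v}

open Classical in
/-- `G` is a `(c, d)`-expander, where `d ≥ 3` and `c > 0`. -/
structure IsExpander {V : Type*} [Fintype V] (G : SimpleGraph V) (c : ℝ) (d : ℕ) : Prop where
  three_le : 3 ≤ d
  pos : 0 < c
  maxDegree_eq : G.maxDegree = d
  expansion : ∀ S : Finset V, (S.card : ℝ) ≤ (Fintype.card V : ℝ) / 2 →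
    c * (S.card : ℝ) ≤ ((openNeighborhood G (S : Set V)).ncard : ℝ)

/-- `g(c, d) = c · log₂(1 + 2^{-d}) / (6 d³)`. -/
noncomputable def expanderExponent (c : ℝ) (d : ℕ) : ℝ :=
  c * Real.logb 2 (1 + (2 : ℝ) ^ (-(d : ℝ))) / (6 * (d : ℝ) ^ 3)

/-! ### Counting vertex covers and expansion -/

section VertexCovers

variable {W : Type*} [Fintype W] [DecidableEq W]

/-! Satisfying assignments of the graph CNF are the vertex covers of `G` (on `V`). Take an
equivalent DNNF and call a gate big if more than two thirds of `V` occurs below it. Every vertex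
cover yields a path of gates of value 1 from the output down to a wire where bigness is lost
(`exists_criticalWire`), so the wires index families that exhaust the vertex covers.

By decomposability, two covers `A`, `B` in one family can be mixed along a balanced set `Y`
depending only on the wire: `A ∩ Y ∪ B \ Y` is again a cover (`CriticalWire.exists_balanced`). Hence
the common intersection `I` of the family meets every edge between `Y` and its complement, and
expansion forces `|I| ≥ c|V|/(3d)`. Requiring a cover to contain `I` costs a factor `1 + 2^{-d}` per
vertex, so each family is an exponentially small fraction of all covers, and there must be many
wires. Finally `size(E) ≤ 3d|V|/2` turns a bound in `|V|` into one in `size(E)`. -/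

open Classical in
/-- The vertex covers of `G` that contain `I`. -/
noncomputable def coversContaining (G : SimpleGraph W) (I : Finset W) : Finset (Finset W) :=
  Finset.univ.filter fun A => G.IsVertexCover (A : Set W) ∧ I ⊆ A

theorem mem_coversContaining {G : SimpleGraph W} {I A : Finset W} :
    A ∈ coversContaining G I ↔ G.IsVertexCover (A : Set W) ∧ I ⊆ A := by
  simp [coversContaining]

/-- Removing `x` from a vertex cover and adding its neighbours shows that a fraction of at least
`1 / (1 + 2 ^ d)` of the vertex covers containing `I` avoid `x`. -/
theorem card_coversContaining_insert_le (G : SimpleGraph W) [DecidableRel G.Adj] {d : ℕ}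
    (hd : ∀ x, G.degree x ≤ d) (I : Finset W) {x : W} (hx : x ∉ I) :
    (1 + 2 ^ d) * (coversContaining G (insert x I)).card
      ≤ 2 ^ d * (coversContaining G I).card := by
  classical
  set B := (coversContaining G I).filter fun A => x ∉ A with hB
  have hsplit : (coversContaining G I).card
      = (coversContaining G (insert x I)).card + B.card := by
    rw [← Finset.card_filter_add_card_filter_not (s := coversContaining G I) (fun A => x ∈ A)]
    congr 2
    ext A
    simp only [Finset.mem_filter, mem_coversContaining, Finset.insert_subset_iff]
    tauto
  have hinj : (coversContaining G (insert x I)).card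
      ≤ (B ×ˢ (G.neighborFinset x).powerset).card := by
    -- The second component remembers `A` on the neighbours of `x`; elsewhere only `x` changes, and
    -- `x ∈ A` is known. So `A` can be recovered, and at most `2 ^ d` covers share a first
    -- component.
    refine Finset.card_le_card_of_injOn
      (fun A => ((A ∪ G.neighborFinset x).erase x, A ∩ G.neighborFinset x)) ?_ ?_
    · intro A hA
      obtain ⟨hA, hI⟩ := mem_coversContaining.1 (Finset.mem_coe.1 hA)
      rw [Finset.insert_subset_iff] at hI
      simp only [hB, Finset.coe_product, Set.mem_prod, Finset.mem_coe, Finset.mem_filter,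
        mem_coversContaining, Finset.mem_powerset, Finset.inter_subset_right, and_true,
        Finset.notMem_erase, not_false_eq_true]
      refine ⟨fun a b hab => ?_, fun y hy => ?_⟩
      · have h := hA hab
        have hne := hab.ne
        simp only [Finset.coe_erase, Finset.coe_union, Set.mem_sdiff, Set.mem_union, Finset.mem_coe,
          SimpleGraph.mem_neighborFinset, Set.mem_singleton_iff] at h ⊢
        by_cases ha : a = x
        · subst ha
          exact Or.inr ⟨Or.inr hab, hne.symm⟩
        · by_cases hb : b = x
          · subst hb
            exact Or.inl ⟨Or.inr hab.symm, hne⟩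
          · tauto
      · have : y ≠ x := fun h => hx (h ▸ hy)
        simp [this, hI.2 hy]
    · intro A hA A' hA' h
      have hxA := (mem_coversContaining.1 (Finset.mem_coe.1 hA)).2 (Finset.mem_insert_self x I)
      have hxA' := (mem_coversContaining.1 (Finset.mem_coe.1 hA')).2 (Finset.mem_insert_self x I)
      simp only [Prod.mk.injEq, Finset.ext_iff, Finset.mem_erase, Finset.mem_union,
        Finset.mem_inter] at h
      ext y
      have h1 := h.1 y
      have h2 := h.2 y
      by_cases hy : y = x
      · subst hy; tauto
      · tauto
  rw [Finset.card_product, Finset.card_powerset] at hinj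
  have hpow : 2 ^ (G.neighborFinset x).card ≤ 2 ^ d := Nat.pow_le_pow_right (by norm_num) (hd x)
  have := hinj.trans (Nat.mul_le_mul_left _ hpow)
  rw [hsplit]
  nlinarith

/-- The elements of `I` are imposed one at a time, each shrinking the count by a factor of at least
`(1 + 2^d) / 2^d = 1 + 2^{-d}`. -/
theorem card_coversContaining_mul_pow_le (G : SimpleGraph W) [DecidableRel G.Adj] {d : ℕ}
    (hd : ∀ x, G.degree x ≤ d) (I : Finset W) :
    ((coversContaining G I).card : ℝ) * (1 + (2 : ℝ) ^ (-(d : ℝ))) ^ I.card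
      ≤ ((coversContaining G ∅).card : ℝ) := by
  induction I using Finset.induction_on with
  | empty => simp
  | insert x I hx ih =>
    rw [Finset.card_insert_of_notMem hx, pow_succ']
    refine le_trans ?_ ih
    rw [← mul_assoc]
    refine mul_le_mul_of_nonneg_right ?_ (by positivity)
    have h := card_coversContaining_insert_le G hd I hx
    have h' : (1 + 2 ^ d) * ((coversContaining G (insert x I)).card : ℝ)
        ≤ 2 ^ d * ((coversContaining G I).card : ℝ) := by exact_mod_cast h
    have hp : (0 : ℝ) < 2 ^ d := by positivity
    rw [Real.rpow_neg (by norm_num), Real.rpow_natCast, ← mul_le_mul_iff_right₀ hp]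
    calc _ = (1 + 2 ^ d) * ((coversContaining G (insert x I)).card : ℝ) := by
          field_simp; ring
      _ ≤ _ := h'

/-- If `I` covers all edges between `S` and its complement, then the open neighbourhood of `S`
has at most `d * |I|` vertices. -/
theorem ncard_openNeighborhood_le (G : SimpleGraph W) [DecidableRel G.Adj] {d : ℕ} (hd1 : 1 ≤ d)
    (hd : ∀ x, G.degree x ≤ d) (I S : Finset W)
    (hI : ∀ x ∈ S, ∀ y ∉ S, G.Adj x y → x ∈ I ∨ y ∈ I) :
    (openNeighborhood G (S : Set W)).ncard ≤ d * I.card := by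
  classical
  -- A vertex of `I` inside `S` is charged with its neighbours, one outside `S` only with itself;
  -- either way at most `d` vertices.
  let F : W → Finset W := fun x => if x ∈ S then G.neighborFinset x else {x}
  have hsub : openNeighborhood G (S : Set W) ⊆ (I.biUnion F : Finset W) := by
    rintro y ⟨hy, x, hx, hxy⟩
    simp only [Finset.mem_coe] at hx hy
    rw [Finset.mem_coe, Finset.mem_biUnion]
    rcases hI x hx y hy hxy with h | h
    · exact ⟨x, h, by simp [F, hx, hxy]⟩
    · exact ⟨y, h, by simp [F, hy]⟩
  refine (Set.ncard_le_ncard hsub (Finset.finite_toSet _)).trans ?_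
  rw [Set.ncard_coe_finset, mul_comm]
  refine Finset.card_biUnion_le_card_mul _ _ _ fun x _ => ?_
  by_cases hx : x ∈ S
  · simpa [F, hx] using hd x
  · simpa [F, hx] using hd1

/-- A family `R` of vertex covers of an expander that is a rectangle with respect to a balanced
partition of the vertices has a large common intersection. -/
theorem card_le_of_balanced_rectangle (G : SimpleGraph W) [DecidableRel G.Adj] {c : ℝ} {d : ℕ}
    (hG : IsExpander G c d) (hd : ∀ x, G.degree x ≤ d) (I Y : Finset W) (R : Set (Finset W))
    (hI : ∀ x, (∀ A ∈ R, x ∈ A) → x ∈ I)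
    (hR : ∀ A ∈ R, ∀ B ∈ R, G.IsVertexCover ((A ∩ Y ∪ B \ Y : Finset W) : Set W))
    (h1 : Fintype.card W ≤ 3 * Y.card) (h2 : 3 * Y.card ≤ 2 * Fintype.card W) :
    c * Fintype.card W ≤ 3 * d * I.card := by
  -- If `A` misses `x` and `B` misses `y`, the mixture of `A` and `B` misses both ends of the edge.
  have hcross : ∀ x ∈ Y, ∀ y ∉ Y, G.Adj x y → x ∈ I ∨ y ∈ I := by
    intro x hx y hy hxy
    by_contra! h
    obtain ⟨A, hA, hxA⟩ : ∃ A ∈ R, x ∉ A := by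
      by_contra! h'; exact h.1 (hI x h')
    obtain ⟨B, hB, hyB⟩ : ∃ B ∈ R, y ∉ B := by
      by_contra! h'; exact h.2 (hI y h')
    have := hR A hA B hB hxy
    simp [hx, hy, hxA, hyB] at this
  -- Expansion only applies to sets of at most half the vertices. The crossing condition is
  -- symmetric and both sides have at least a third of them, so the smaller side serves.
  obtain ⟨S, hS, hS1, hS2⟩ : ∃ S : Finset W,
      (∀ x ∈ S, ∀ y ∉ S, G.Adj x y → x ∈ I ∨ y ∈ I) ∧ Fintype.card W ≤ 3 * S.card ∧
        2 * S.card ≤ Fintype.card W := by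
    by_cases h : 2 * Y.card ≤ Fintype.card W
    · exact ⟨Y, hcross, h1, h⟩
    · refine ⟨Yᶜ, fun x hx y hy hxy => ?_, ?_, ?_⟩
      · simp only [Finset.mem_compl, not_not] at hx hy
        exact (hcross y hy x hx hxy.symm).symm
      all_goals rw [Finset.card_compl]; omega
  have hd1 : 1 ≤ d := le_trans (by norm_num) hG.three_le
  have hexp := hG.expansion S (by
    rw [le_div_iff₀ (by norm_num)]
    have : ((2 * S.card : ℕ) : ℝ) ≤ (Fintype.card W : ℝ) := by exact_mod_cast hS2
    push_cast at this; linarith)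
  have hN : ((openNeighborhood G (S : Set W)).ncard : ℝ) ≤ d * I.card := by
    exact_mod_cast ncard_openNeighborhood_le G hd1 hd I S hS
  have hS1' : (Fintype.card W : ℝ) ≤ 3 * S.card := by exact_mod_cast hS1
  have := mul_le_mul_of_nonneg_left hS1' hG.pos.le
  linarith

end VertexCovers

/-! ### Paths of satisfied gates and critical wires -/

namespace NNF

variable {X : Type u}

theorem varsAt_mono (C : NNF X) {u v : C.Gate} (h : C.wire u v) : C.varsAt u ⊆ C.varsAt v := by
  rintro x ⟨w, b, hw, hl⟩
  exact ⟨w, b, hw.tail h, hl⟩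

theorem satAt_congr (C : NNF X) {f g : X → Bool} {v : C.Gate}
    (h : ∀ x ∈ C.varsAt v, f x = g x) : C.SatAt f v ↔ C.SatAt g v := by
  induction v using C.wellFounded.induction with
  | _ v ih =>
    have ih' : ∀ u, C.wire u v → (C.SatAt f u ↔ C.SatAt g u) := fun u hu =>
      ih u hu fun x hx => h x (C.varsAt_mono hu hx)
    rw [C.satAt_iff f v, C.satAt_iff g v]
    cases hl : C.label v with
    | const b => rfl
    | lit x b => simp only [h x ⟨v, b, Relation.ReflTransGen.refl, hl⟩]
    | and => exact forall₂_congr ih'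
    | or => exact exists_congr fun u => and_congr_right (ih' u)

theorem satAt_of_and (C : NNF X) {f : X → Bool} {v : C.Gate} (hl : C.label v = .and) :
    C.SatAt f v ↔ ∀ u, C.wire u v → C.SatAt f u := by
  rw [satAt_iff, hl]

theorem satAt_of_or (C : NNF X) {f : X → Bool} {v : C.Gate} (hl : C.label v = .or) :
    C.SatAt f v ↔ ∃ u, C.wire u v ∧ C.SatAt f u := by
  rw [satAt_iff, hl]

theorem label_eq_and_or_of_wire (C : NNF X) {u v : C.Gate} (h : C.wire u v) :
    C.label v = .and ∨ C.label v = .or := by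
  have := mt (C.isInput_iff v).1 fun h' => h' u h
  cases hl : C.label v <;> simp_all [GateLabel.IsInput]

/-- There is a directed path from `v` to the output gate whose gates after `v` all have value `1`
under `f`. -/
def SatPath (C : NNF X) (f : X → Bool) (v : C.Gate) : Prop :=
  Relation.ReflTransGen (fun u w => C.wire u w ∧ C.SatAt f w) v C.out

/-- Value 1 propagates up the path: an `∨`-gate needs only its input on the path, and the other
inputs of an `∧`-gate have, by decomposability, no variable of `Y` below them, so they keep the
value 1 they have under `g`. -/
theorem SatPath.sat {C : NNF X} (hC : C.IsDecomposable) {f g : X → Bool} {Y : Set X} {v : C.Gate}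
    (hfg : ∀ x ∉ Y, f x = g x) (hp : C.SatPath g v) (hY : Y ⊆ C.varsAt v) (hf : C.SatAt f v) :
    C.Sat f := by
  induction hp using Relation.ReflTransGen.head_induction_on with
  | refl => exact hf
  | @head u w h _ ih =>
    obtain ⟨hw, hg⟩ := h
    refine ih (hY.trans (C.varsAt_mono hw)) ?_
    rcases C.label_eq_and_or_of_wire hw with hl | hl
    · rw [C.satAt_of_and hl] at hg ⊢
      intro u' hu'
      by_cases hne : u' = u
      · exact hne ▸ hf
      · refine (C.satAt_congr fun x hx => hfg x fun hxY => ?_).2 (hg u' hu')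
        exact Set.disjoint_left.1 (hC w hl u' u hu' hw hne) hx (hY hxY)
    · exact (C.satAt_of_or hl).2 ⟨u, hw, hf⟩

/-- A wire from a gate outside `big` to a gate in `big`, whose head is an `∨`-gate or an `∧`-gate
all of whose inputs are outside `big`. -/
def CriticalWire (C : NNF X) (big : C.Gate → Prop) (w v : C.Gate) : Prop :=
  C.wire w v ∧ big v ∧ ¬ big w ∧
    (C.label v = .or ∨ C.label v = .and ∧ ∀ u, C.wire u v → ¬ big u)

/-- Descend from the output through big gates of value 1. At an `∧`-gate prefer a big input; if none
exists, any input wire is critical. At an `∨`-gate take any input of value 1; if it is not big, the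
wire is critical. Input gates are not big, so the descent stops. -/
theorem exists_criticalWire (C : NNF X) (big : C.Gate → Prop)
    (hin : ∀ v, (C.label v).IsInput → ¬ big v) (hout : big C.out) {f : X → Bool} (hf : C.Sat f) :
    ∃ w v, C.CriticalWire big w v ∧ C.SatAt f w ∧ C.SatAt f v ∧ C.SatPath f v := by
  suffices H : ∀ v, big v → C.SatAt f v → C.SatPath f v →
      ∃ w v, C.CriticalWire big w v ∧ C.SatAt f w ∧ C.SatAt f v ∧ C.SatPath f v from
    H C.out hout hf Relation.ReflTransGen.refl
  intro v
  induction v using C.wellFounded.induction with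
  | _ v ih =>
    intro hv hs hp
    have hni := fun h => hin v h hv
    cases hl : C.label v with
    | const b => simp [hl, GateLabel.IsInput] at hni
    | lit x b => simp [hl, GateLabel.IsInput] at hni
    | and =>
      have hch := (C.satAt_of_and hl).1 hs
      by_cases h : ∃ u, C.wire u v ∧ big u
      · obtain ⟨u, hu, hb⟩ := h
        exact ih u hu hb (hch u hu) (hp.head ⟨hu, hs⟩)
      · push Not at h
        obtain ⟨w, hw⟩ : ∃ w, C.wire w v := by
          by_contra! h'
          exact hni ((C.isInput_iff v).2 h')
        exact ⟨w, v, ⟨hw, hv, h w hw, Or.inr ⟨hl, h⟩⟩, hch w hw, hs, hp⟩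
    | or =>
      obtain ⟨w, hw, hsw⟩ := (C.satAt_of_or hl).1 hs
      by_cases hb : big w
      · exact ih w hw hb hsw (hp.head ⟨hw, hs⟩)
      · exact ⟨w, v, ⟨hw, hv, hb, Or.inl hl⟩, hsw, hs, hp⟩

/-! ### Balanced partitions from critical wires -/

section Vertices

variable {V : Finset X}

open Classical in
/-- The elements of `V` that occur below the gate `v`. -/
noncomputable def varsIn (C : NNF X) (V : Finset X) (v : C.Gate) : Finset V :=
  Finset.univ.filter fun x => (x : X) ∈ C.varsAt v

theorem mem_varsIn {C : NNF X} {v : C.Gate} {x : V} :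
    x ∈ C.varsIn V v ↔ (x : X) ∈ C.varsAt v := by
  simp [varsIn]

open Classical in
/-- The assignment that maps exactly the elements of `A` to `1`. -/
noncomputable def indicatorAssignment (A : Finset V) (x : X) : Bool :=
  decide (∃ h : x ∈ V, (⟨x, h⟩ : V) ∈ A)

theorem indicatorAssignment_coe (A : Finset V) (x : V) :
    indicatorAssignment A (x : X) = true ↔ x ∈ A := by
  simp [indicatorAssignment]

theorem indicatorAssignment_congr {A B : Finset V} {x : X}
    (h : ∀ hx : x ∈ V, (⟨x, hx⟩ : V) ∈ A ↔ (⟨x, hx⟩ : V) ∈ B) :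
    indicatorAssignment A x = indicatorAssignment B x := by
  simp only [indicatorAssignment]
  congr 1
  exact propext (exists_congr h)

/-- Add the sets one by one until the union reaches `n / 3`. Either the last set alone is that
large, or it and the previous union are both below `n / 3`, so together below `2n / 3`. -/
theorem exists_balanced_biUnion {ι W : Type*} [DecidableEq W] (F : ι → Finset W) {n : ℕ}
    (T : Finset ι) (hF : ∀ i ∈ T, 3 * (F i).card ≤ 2 * n) (hT : n ≤ 3 * (T.biUnion F).card) :
    ∃ T' ⊆ T, n ≤ 3 * (T'.biUnion F).card ∧ 3 * (T'.biUnion F).card ≤ 2 * n := by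
  classical
  induction T using Finset.induction_on with
  | empty => exact ⟨∅, subset_rfl, hT, by simp⟩
  | insert a T ha ih =>
    by_cases h : n ≤ 3 * (T.biUnion F).card
    · obtain ⟨T', hT', h'⟩ := ih (fun i hi => hF i (Finset.mem_insert_of_mem hi)) h
      exact ⟨T', hT'.trans (Finset.subset_insert _ _), h'⟩
    · by_cases h' : n ≤ 3 * (F a).card
      · exact ⟨{a}, by simp, by simpa using h', by simpa using hF a (Finset.mem_insert_self _ _)⟩
      · refine ⟨insert a T, subset_rfl, hT, ?_⟩
        have := Finset.card_union_le (F a) (T.biUnion F)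
        rw [Finset.biUnion_insert]
        omega

/-- A critical wire with respect to the gates that have more than two thirds of `V` below them
gives a balanced partition of `V` along which satisfying assignments can be combined. -/
theorem CriticalWire.exists_balanced {C : NNF X} (hC : C.IsDecomposable) (hV : 2 ≤ V.card)
    [DecidableEq V] {w v : C.Gate}
    (h : C.CriticalWire (fun u => 2 * V.card < 3 * (C.varsIn V u).card) w v) :
    ∃ Y : Finset V, V.card ≤ 3 * Y.card ∧ 3 * Y.card ≤ 2 * V.card ∧
      ∀ A B : Finset V, C.SatAt (indicatorAssignment A) w → C.SatPath (indicatorAssignment A) v →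
        C.SatAt (indicatorAssignment A) v →
        C.SatPath (indicatorAssignment B) v → C.SatAt (indicatorAssignment B) v →
        C.Sat (indicatorAssignment (A ∩ Y ∪ B \ Y)) := by
  obtain ⟨hw, hv, hnw, hl⟩ := h
  -- Since `Y` lies below `v`, it suffices that the mixed assignment satisfies `v`; the path for `B`
  -- does the rest.
  have key : ∀ Y : Finset V, Y ⊆ C.varsIn V v → ∀ A B : Finset V,
      C.SatPath (indicatorAssignment B) v →
      C.SatAt (indicatorAssignment (A ∩ Y ∪ B \ Y)) v →
      C.Sat (indicatorAssignment (A ∩ Y ∪ B \ Y)) := by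
    intro Y hY A B hp hs
    refine hp.sat hC (Y := Subtype.val '' (Y : Set V)) (fun x hx => ?_) ?_ hs
    · refine indicatorAssignment_congr fun hxV => ?_
      have : (⟨x, hxV⟩ : V) ∉ Y := fun h' => hx ⟨_, h', rfl⟩
      simp [this]
    · rintro _ ⟨x, hx, rfl⟩
      exact mem_varsIn.1 (hY hx)
  have agree : ∀ (Y A B : Finset V) (u : C.Gate), C.varsIn V u ⊆ Y →
      C.SatAt (indicatorAssignment A) u → C.SatAt (indicatorAssignment (A ∩ Y ∪ B \ Y)) u := by
    intro Y A B u hu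
    refine (C.satAt_congr fun x hx => indicatorAssignment_congr fun hxV => ?_).1
    have : (⟨x, hxV⟩ : V) ∈ Y := hu (mem_varsIn.2 hx)
    simp [this]
  have agree' : ∀ (Y A B : Finset V) (u : C.Gate), Disjoint (C.varsIn V u) Y →
      C.SatAt (indicatorAssignment B) u → C.SatAt (indicatorAssignment (A ∩ Y ∪ B \ Y)) u := by
    intro Y A B u hu
    refine (C.satAt_congr fun x hx => indicatorAssignment_congr fun hxV => ?_).1
    have : (⟨x, hxV⟩ : V) ∉ Y := Finset.disjoint_left.1 hu (mem_varsIn.2 hx)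
    simp [this]
  rcases hl with hl | ⟨hl, hsmall⟩
  · have hsub : C.varsIn V w ⊆ C.varsIn V v := fun x hx =>
      mem_varsIn.2 (C.varsAt_mono hw (mem_varsIn.1 hx))
    -- For an `∨`-gate, the set below `w` may be too small and is padded inside the set below `v` to
    -- `⌈n / 3⌉` elements, which is at most `2n / 3` because `n ≥ 2`.
    obtain ⟨Y, hwY, hYv, hY⟩ := Finset.exists_subsuperset_card_eq hsub
      (n := max (C.varsIn V w).card ((V.card + 2) / 3)) (le_max_left _ _) (by
        have := Finset.card_le_card hsub
        omega)
    refine ⟨Y, by omega, by omega, fun A B hA _ _ hp _ => key Y hYv A B hp ?_⟩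
    exact (C.satAt_of_or hl).2 ⟨w, hw, agree Y A B w hwY hA⟩
  · classical
    have := C.finite
    have := Fintype.ofFinite C.Gate
    set T : Finset C.Gate := Finset.univ.filter fun u => C.wire u v with hT
    have hTv : T.biUnion (C.varsIn V) = C.varsIn V v := by
      ext x
      simp only [hT, Finset.mem_biUnion, Finset.mem_filter, Finset.mem_univ, true_and, mem_varsIn]
      constructor
      · rintro ⟨u, hu, hx⟩
        exact C.varsAt_mono hu hx
      · rintro ⟨y, b, hy, hyl⟩
        rcases Relation.ReflTransGen.cases_tail hy with rfl | ⟨u, hu, huv⟩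
        · simp [hl] at hyl
        · exact ⟨u, huv, y, b, hu, hyl⟩
    -- For an `∧`-gate, `Y` collects the vertices below some of the inputs: these inputs see only
    -- `A`, and the remaining ones, being disjoint from them, see only `B`.
    obtain ⟨T', hT'T, h1, h2⟩ := exists_balanced_biUnion (C.varsIn V) (n := V.card) T
      (fun u hu => not_lt.1 (hsmall u (Finset.mem_filter.1 hu).2)) (by rw [hTv]; omega)
    refine ⟨T'.biUnion (C.varsIn V), h1, h2, fun A B _ _ hA hp hB => key _ ?_ A B hp ?_⟩
    · rw [← hTv]
      exact Finset.biUnion_subset_biUnion_of_subset_left _ hT'T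
    · rw [C.satAt_of_and hl] at hA hB ⊢
      intro u hu
      by_cases huT : u ∈ T'
      · exact agree _ A B u (Finset.subset_biUnion_of_mem _ huT) (hA u hu)
      · refine agree' _ A B u ?_ (hB u hu)
        rw [Finset.disjoint_biUnion_right]
        intro u' hu'
        have hne : u ≠ u' := fun h => huT (h ▸ hu')
        have hd := hC v hl u u' hu (Finset.mem_filter.1 (hT'T hu')).2 hne
        exact Finset.disjoint_left.2 fun x hx hx' =>
          Set.disjoint_left.1 hd (mem_varsIn.1 hx) (mem_varsIn.1 hx')

end Vertices

end NNF

/-! ### Semantics and size of the graph CNF -/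

section GraphCNF

variable {X : Type u} {V : Finset X}

theorem graphCNF_sat_iff {G : SimpleGraph V} (hG : G ≠ ⊥) (f : X → Bool) :
    (graphCNF G).Sat f ↔ ∀ x y : V, G.Adj x y → f x = true ∨ f y = true := by
  have hvar : ∀ x : G.support, (graphCNF G).SatAt f (.var x) ↔ f ((x : V) : X) = true := by
    intro x
    rw [NNF.satAt_iff]
    rfl
  have hclause : ∀ e : G.edgeSet, (graphCNF G).SatAt f (.clause e) ↔
      ∃ x : G.support, (x : V) ∈ (e : Sym2 V) ∧ f ((x : V) : X) = true := by
    intro e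
    rw [NNF.satAt_of_or _ rfl]
    constructor
    · rintro ⟨_, ⟨⟩ | ⟨x, _, hx⟩, hu⟩
      exact ⟨x, hx, (hvar x).1 hu⟩
    · rintro ⟨x, hx, hf⟩
      exact ⟨.var x, .toClause x e hx, (hvar x).2 hf⟩
  have hout : (graphCNF G).label (graphCNF G).out = .and := by
    simp [graphCNFLabel, hG]
  rw [NNF.Sat, NNF.satAt_of_and _ hout]
  constructor
  · intro h x y hxy
    obtain ⟨z, hz, hf⟩ := (hclause ⟨s(x, y), hxy⟩).1 (h _ (.toOut _))
    rcases Sym2.mem_iff.1 hz with hz | hz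
    · exact Or.inl (hz ▸ hf)
    · exact Or.inr (hz ▸ hf)
  · rintro h _ ⟨⟨e, he⟩⟩
    induction e using Sym2.ind with
    | _ x y =>
      rw [hclause]
      rcases h x y he with h | h
      · exact ⟨⟨x, y, he⟩, by simp, h⟩
      · exact ⟨⟨y, x, SimpleGraph.Adj.symm he⟩, by simp, h⟩

theorem graphCNF_sat_indicator_iff {G : SimpleGraph V} (hG : G ≠ ⊥) (A : Finset V) :
    (graphCNF G).Sat (NNF.indicatorAssignment A) ↔ G.IsVertexCover (A : Set V) := by
  rw [graphCNF_sat_iff hG]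
  simp only [NNF.indicatorAssignment_coe]
  rfl

/-- There is one wire per edge into the output and one per dart into the clauses, hence at most
`3|E|` wires, while `2|E| ≤ d|V|` by summing degrees. -/
theorem two_mul_size_graphCNF_le (G : SimpleGraph V) [DecidableRel G.Adj] {d : ℕ}
    (hd : ∀ x, G.degree x ≤ d) : 2 * (graphCNF G).size ≤ 3 * d * V.card := by
  classical
  let F : G.edgeSet ⊕ G.Dart → GraphCNFGate G × GraphCNFGate G := fun
    | .inl e => (.clause e, .out)
    | .inr a => (.var ⟨a.fst, a.snd, a.adj⟩, .clause ⟨a.edge, a.edge_mem⟩)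
  have hsub : {p : GraphCNFGate G × GraphCNFGate G | GraphCNFWire G p.1 p.2} ⊆ Set.range F := by
    rintro ⟨u, v⟩ h
    cases h with
    | toOut e => exact ⟨.inl e, rfl⟩
    | toClause x e h =>
      obtain ⟨e, he⟩ := e
      obtain ⟨y, rfl⟩ := Sym2.mem_iff_exists.1 h
      exact ⟨.inr ⟨((x : V), y), he⟩, rfl⟩
  have hsize : (graphCNF G).size ≤ Fintype.card (G.edgeSet ⊕ G.Dart) := by
    refine (Set.ncard_le_ncard hsub (Set.finite_range F)).trans ?_
    rw [← Set.image_univ]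
    refine (Set.ncard_image_le Set.finite_univ).trans ?_
    rw [Set.ncard_univ, Nat.card_eq_fintype_card]
  have hdeg : ∑ x, G.degree x ≤ V.card * d := by
    have := Finset.sum_le_card_nsmul Finset.univ (fun x => G.degree x) d fun x _ => hd x
    simpa using this
  have h1 := G.dart_card_eq_twice_card_edges
  have h2 := G.dart_card_eq_sum_degrees
  rw [Fintype.card_sum, ← SimpleGraph.edgeFinset_card] at hsize
  nlinarith

/-! ### Existence of an equivalent DNNF -/

/-- The gates of the disjunction of all terms over `V` given by the sets in `𝓐`. -/
inductive TermGate (𝓐 : Set (Finset V)) : Type u where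
  | out
  | term (A : 𝓐)
  | lit (A : 𝓐) (x : V)

/-- The wires of the disjunction of all terms over `V` given by the sets in `𝓐`. -/
inductive TermWire (𝓐 : Set (Finset V)) : TermGate 𝓐 → TermGate 𝓐 → Prop where
  | toOut (A : 𝓐) : TermWire 𝓐 (.term A) .out
  | toTerm (A : 𝓐) (x : V) : TermWire 𝓐 (.lit A x) (.term A)

/-- The labels of the disjunction of all terms over `V` given by the sets in `𝓐`. -/
noncomputable def termLabel (𝓐 : Set (Finset V)) : TermGate 𝓐 → GateLabel X
  | .out => .or
  | .term _ => .and
  | .lit A x => .lit (x : X) (NNF.indicatorAssignment (A : Finset V) (x : X))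

/-- The DNNF that accepts the assignments whose restriction to `V` is given by a set in `𝓐`. -/
noncomputable abbrev termDNNF (𝓐 : Set (Finset V)) (hV : V.Nonempty) (h𝓐 : 𝓐.Nonempty) :
    NNF X where
  Gate := TermGate 𝓐
  finite := by
    let F : TermGate 𝓐 → Option (𝓐 ⊕ 𝓐 × V) := fun
      | .out => none
      | .term A => some (.inl A)
      | .lit A x => some (.inr (A, x))
    refine Finite.of_injective F ?_
    intro a b h
    cases a <;> cases b <;> simp_all [F]
  wire := TermWire 𝓐
  acyclic := by
    let r : TermGate 𝓐 → ℕ := fun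
      | .out => 2
      | .term _ => 1
      | .lit _ _ => 0
    have key : ∀ a b, Relation.TransGen (TermWire 𝓐) a b → r a < r b := by
      intro a b h
      induction h with
      | single h => cases h <;> simp [r]
      | tail _ h ih => exact ih.trans (by cases h <;> simp [r])
    exact fun v h => lt_irrefl _ (key v v h)
  label := termLabel 𝓐
  out := .out
  isSink_iff := by
    intro v
    constructor
    · intro h
      cases v with
      | out => rfl
      | term A => exact absurd (TermWire.toOut A) (h _)
      | lit A x => exact absurd (TermWire.toTerm A x) (h _)
    · rintro rfl w h
      cases h
  isInput_iff := by
    intro v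
    cases v with
    | out =>
      obtain ⟨A, hA⟩ := h𝓐
      simp only [termLabel, GateLabel.IsInput, false_iff]
      exact fun h => h _ (TermWire.toOut ⟨A, hA⟩)
    | term A =>
      obtain ⟨x, hx⟩ := hV
      simp only [termLabel, GateLabel.IsInput, false_iff]
      exact fun h => h _ (TermWire.toTerm A ⟨x, hx⟩)
    | lit A x =>
      simp only [termLabel, GateLabel.IsInput, true_iff]
      intro u hu
      cases hu

theorem termDNNF_isDecomposable (𝓐 : Set (Finset V)) (hV : V.Nonempty) (h𝓐 : 𝓐.Nonempty) :
    (termDNNF 𝓐 hV h𝓐).IsDecomposable := by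
  have hvars : ∀ A x y, y ∈ (termDNNF 𝓐 hV h𝓐).varsAt (.lit A x) → y = (x : X) := by
    rintro A x y ⟨u, b, hu, hl⟩
    rcases Relation.ReflTransGen.cases_tail hu with rfl | ⟨_, _, ⟨⟩⟩
    simp only [termLabel, GateLabel.lit.injEq] at hl
    exact hl.1.symm
  intro v hv u u' hu hu' hne
  cases v with
  | out => simp [termLabel] at hv
  | lit A x => simp [termLabel] at hv
  | term A =>
    cases hu with
    | toTerm _ x =>
      cases hu' with
      | toTerm _ x' =>
        refine Set.disjoint_left.2 fun y hy hy' => hne ?_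
        have : x = x' := Subtype.ext ((hvars A x y hy).symm.trans (hvars A x' y hy'))
        rw [this]

theorem termDNNF_sat_iff (𝓐 : Set (Finset V)) (hV : V.Nonempty) (h𝓐 : 𝓐.Nonempty)
    (f : X → Bool) : (termDNNF 𝓐 hV h𝓐).Sat f ↔
      ∃ A ∈ 𝓐, ∀ x : V, f (x : X) = NNF.indicatorAssignment A (x : X) := by
  have hlit : ∀ A x, (termDNNF 𝓐 hV h𝓐).SatAt f (.lit A x) ↔
      f (x : X) = NNF.indicatorAssignment (A : Finset V) (x : X) := by
    intro A x
    rw [NNF.satAt_iff]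
    rfl
  have hterm : ∀ A, (termDNNF 𝓐 hV h𝓐).SatAt f (.term A) ↔
      ∀ x : V, f (x : X) = NNF.indicatorAssignment (A : Finset V) (x : X) := by
    intro A
    rw [NNF.satAt_of_and _ rfl]
    constructor
    · exact fun h x => (hlit A x).1 (h _ (.toTerm A x))
    · intro h u hu
      cases hu with
      | toTerm _ x => exact (hlit A x).2 (h x)
  rw [NNF.Sat, NNF.satAt_of_or _ rfl]
  constructor
  · rintro ⟨_, ⟨A⟩, h⟩
    exact ⟨A, A.2, (hterm A).1 h⟩
  · rintro ⟨A, hA, h⟩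
    exact ⟨.term ⟨A, hA⟩, .toOut _, (hterm _).2 h⟩

/-- Needed because `dnnfSize` is an `sInf` in `ℕ`, which would be `0` for an empty set. The witness
is the disjunction of the full terms of all vertex covers. -/
theorem exists_dnnf_equivalent_graphCNF {G : SimpleGraph V} (hV : V.Nonempty) (hG : G ≠ ⊥) :
    ∃ D : NNF X, D.IsDecomposable ∧ D.Equivalent (graphCNF G) := by
  classical
  have hne : {A : Finset V | G.IsVertexCover (A : Set V)}.Nonempty := ⟨Finset.univ, by simp⟩
  refine ⟨termDNNF _ hV hne,
    termDNNF_isDecomposable _ _ _, fun f => ?_⟩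
  have hiff : ∀ A : Finset V, (∀ x : V, f (x : X) = NNF.indicatorAssignment A (x : X)) →
      ((graphCNF G).Sat f ↔ G.IsVertexCover (A : Set V)) := by
    intro A hA
    rw [← graphCNF_sat_indicator_iff hG, graphCNF_sat_iff hG, graphCNF_sat_iff hG]
    simp only [hA]
  rw [termDNNF_sat_iff _ hV hne]
  constructor
  · rintro ⟨A, hA, h⟩
    exact (hiff A h).2 hA
  · intro h
    have hf : ∀ x : V, f (x : X) = NNF.indicatorAssignment
        (Finset.univ.filter fun x : V => f (x : X) = true) (x : X) := by
      intro x
      rw [Bool.eq_iff_iff, NNF.indicatorAssignment_coe]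
      simp
    exact ⟨_, (hiff _ hf).1 h, hf⟩

/-- A circuit equivalent to the graph CNF of a graph mentions every non-isolated vertex. -/
theorem mem_varsIn_out {G : SimpleGraph V} (hG : G ≠ ⊥) {D : NNF X}
    (hD : D.Equivalent (graphCNF G)) {x y : V} (hxy : G.Adj x y) : x ∈ D.varsIn V D.out := by
  classical
  by_contra hx
  rw [NNF.mem_varsIn] at hx
  -- All vertices but `y` form a cover. If `x` were not below the output, removing `x` too would go
  -- unnoticed by `D`, yet it uncovers the edge `xy`.
  have h1 : D.Sat (NNF.indicatorAssignment (Finset.univ.erase y)) := by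
    rw [hD _, graphCNF_sat_indicator_iff hG]
    intro a b hab
    have := hab.ne
    simp only [Finset.coe_erase, Finset.coe_univ, Set.mem_sdiff, Set.mem_univ, true_and,
      Set.mem_singleton_iff]
    by_contra! h
    exact this (h.1.trans h.2.symm)
  have h2 : D.Sat (NNF.indicatorAssignment ((Finset.univ.erase y).erase x)) := by
    refine (D.satAt_congr fun z hz => NNF.indicatorAssignment_congr fun hzV => ?_).1 h1
    have : (⟨z, hzV⟩ : V) ≠ x := by
      rintro rfl
      exact hx hz
    simp [this]
  rw [hD _, graphCNF_sat_indicator_iff hG] at h2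
  simpa using h2 hxy

/-! ### The lower bound by rectangle covering -/

/-- A family of vertex covers of an expander that is a rectangle with respect to a balanced
partition contains only a small fraction of all vertex covers. -/
theorem card_balanced_rectangle_mul_le {W : Type*} [Fintype W] [DecidableEq W]
    (G : SimpleGraph W) [DecidableRel G.Adj] {c : ℝ} {d : ℕ}
    (hG : IsExpander G c d) (hd : ∀ x, G.degree x ≤ d) (Y : Finset W) (R : Finset (Finset W))
    (hcov : ∀ A ∈ R, G.IsVertexCover (A : Set W))
    (hR : ∀ A ∈ R, ∀ B ∈ R, G.IsVertexCover ((A ∩ Y ∪ B \ Y : Finset W) : Set W))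
    (h1 : Fintype.card W ≤ 3 * Y.card) (h2 : 3 * Y.card ≤ 2 * Fintype.card W) :
    (R.card : ℝ) * (1 + (2 : ℝ) ^ (-(d : ℝ))) ^ (c * Fintype.card W / (3 * d))
      ≤ (coversContaining G ∅).card := by
  set I : Finset W := Finset.univ.filter fun x => ∀ A ∈ R, x ∈ A with hI
  have hle := card_le_of_balanced_rectangle G hG hd I Y (R : Set (Finset W))
    (fun x hx => by simpa [hI] using hx) hR h1 h2
  have hd0 : (0 : ℝ) < d := by
    have := hG.three_le
    exact_mod_cast (by omega : 0 < d)
  have hpow : (0 : ℝ) < (2 : ℝ) ^ (-(d : ℝ)) := by positivity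
  have hsub : R ⊆ coversContaining G I := fun A hA =>
    mem_coversContaining.2 ⟨hcov A hA, fun x hx => (Finset.mem_filter.1 hx).2 A hA⟩
  have hcard : (R.card : ℝ) ≤ (coversContaining G I).card := by
    exact_mod_cast Finset.card_le_card hsub
  refine le_trans ?_ (card_coversContaining_mul_pow_le G hd I)
  refine mul_le_mul hcard ?_ (by positivity) (by positivity)
  rw [← Real.rpow_natCast]
  refine Real.rpow_le_rpow_of_exponent_le (by linarith) ?_
  rw [div_le_iff₀ (by positivity)]
  linarith

theorem rpow_le_size_of_equivalent_graphCNF {G : SimpleGraph V} [DecidableEq V]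
    [DecidableRel G.Adj] {c : ℝ} {d : ℕ} (hV : 4 ≤ V.card) (hG : IsExpander G c d)
    (hd : ∀ x, G.degree x ≤ d) (hbot : G ≠ ⊥) {D : NNF X} (hD : D.IsDecomposable)
    (hDG : D.Equivalent (graphCNF G)) :
    (1 + (2 : ℝ) ^ (-(d : ℝ))) ^ (c * V.card / (3 * d)) ≤ D.size := by
  classical
  have := D.finite
  have hsat : ∀ A : Finset V, D.Sat (NNF.indicatorAssignment A) ↔ G.IsVertexCover (A : Set V) :=
    fun A => (hDG _).trans (graphCNF_sat_indicator_iff hbot A)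
  -- Expansion of singletons excludes isolated vertices, so all of `V` occurs below the output of
  -- `D`.
  have hadj : ∀ x : V, ∃ y, G.Adj x y := by
    intro x
    have hV' : (4 : ℝ) ≤ V.card := by exact_mod_cast hV
    have h := hG.expansion {x} (by
      rw [Fintype.card_coe, Finset.card_singleton]
      push_cast
      linarith)
    rw [Finset.card_singleton, Nat.cast_one, mul_one] at h
    have hpos : 0 < (openNeighborhood G (({x} : Finset V) : Set V)).ncard := by
      exact_mod_cast hG.pos.trans_le h
    obtain ⟨y, -, z, hz, hzy⟩ := (Set.ncard_pos (Set.toFinite _)).1 hpos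
    have hzx : z = x := by simpa using hz
    exact ⟨y, hzx ▸ hzy⟩
  set big : D.Gate → Prop := fun u => 2 * V.card < 3 * (D.varsIn V u).card with hbig
  have hout : big D.out := by
    have : D.varsIn V D.out = Finset.univ := Finset.eq_univ_iff_forall.2 fun x => by
      obtain ⟨y, hy⟩ := hadj x
      exact mem_varsIn_out hbot hDG hy
    simp only [hbig, this, Finset.card_univ, Fintype.card_coe]
    omega
  have hin : ∀ v, (D.label v).IsInput → ¬ big v := by
    intro v hv hb
    have hle : (D.varsIn V v).card ≤ 1 := by
      refine Finset.card_le_one.2 fun x hx y hy => Subtype.ext ?_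
      obtain ⟨u, b, hu, hl⟩ := NNF.mem_varsIn.1 hx
      obtain ⟨u', b', hu', hl'⟩ := NNF.mem_varsIn.1 hy
      have hnw := (D.isInput_iff v).1 hv
      rcases Relation.ReflTransGen.cases_tail hu with rfl | ⟨_, _, h⟩
      · rcases Relation.ReflTransGen.cases_tail hu' with rfl | ⟨_, _, h⟩
        · rw [hl, GateLabel.lit.injEq] at hl'
          exact hl'.1
        · exact absurd h (hnw _)
      · exact absurd h (hnw _)
    simp only [hbig] at hb
    omega
  set wires : Finset (D.Gate × D.Gate) :=
    (Set.toFinite {p : D.Gate × D.Gate | D.wire p.1 p.2}).toFinset with hwires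
  let R : D.Gate × D.Gate → Finset (Finset V) := fun p => Finset.univ.filter fun A =>
    D.CriticalWire big p.1 p.2 ∧ D.SatAt (NNF.indicatorAssignment A) p.1 ∧
      D.SatAt (NNF.indicatorAssignment A) p.2 ∧ D.SatPath (NNF.indicatorAssignment A) p.2 ∧
        D.Sat (NNF.indicatorAssignment A)
  have hsize : wires.card = D.size := (Set.ncard_eq_toFinset_card _ _).symm
  set b : ℝ := (1 + (2 : ℝ) ^ (-(d : ℝ))) ^ (c * V.card / (3 * d)) with hb
  have hb0 : 0 < b := by positivity
  -- The family of a non-critical wire is empty; that of a critical one is a balanced rectangle.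
  have hRb : ∀ p, ((R p).card : ℝ) * b ≤ (coversContaining G ∅).card := by
    intro p
    rcases (R p).eq_empty_or_nonempty with h | ⟨A, hA⟩
    · simp [h]
    · obtain ⟨Y, h1, h2, hY⟩ := (Finset.mem_filter.1 hA).2.1.exists_balanced hD (by omega)
      have := card_balanced_rectangle_mul_le G hG hd Y (R p)
        (fun A hA => (hsat A).1 (Finset.mem_filter.1 hA).2.2.2.2.2)
        (fun A hA B hB => by
          obtain ⟨-, -, hAw, hAv, hAp, -⟩ := Finset.mem_filter.1 hA
          obtain ⟨-, -, -, hBv, hBp, -⟩ := Finset.mem_filter.1 hB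
          exact (hsat _).1 (hY A B hAw hAp hAv hBp hBv))
        (by rwa [Fintype.card_coe]) (by rwa [Fintype.card_coe])
      rwa [Fintype.card_coe] at this
  have hcover : coversContaining G ∅ ⊆ wires.biUnion R := by
    intro A hA
    have hs := (hsat A).2 (mem_coversContaining.1 hA).1
    obtain ⟨w, v, hcrit, hw, hv, hp⟩ := D.exists_criticalWire big hin hout hs
    refine Finset.mem_biUnion.2 ⟨(w, v), by simpa [hwires] using hcrit.1, ?_⟩
    exact Finset.mem_filter.2 ⟨Finset.mem_univ _, hcrit, hw, hv, hp, hs⟩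
  have hpos : (0 : ℝ) < (coversContaining G ∅).card := by
    have : Finset.univ ∈ coversContaining G ∅ := mem_coversContaining.2 ⟨by simp, by simp⟩
    exact_mod_cast Finset.card_pos.2 ⟨_, this⟩
  have hsum : ((coversContaining G ∅).card : ℝ) ≤ ∑ p ∈ wires, ((R p).card : ℝ) := by
    exact_mod_cast (Finset.card_le_card hcover).trans Finset.card_biUnion_le
  have hfinal : ((coversContaining G ∅).card : ℝ) * b
      ≤ D.size * (coversContaining G ∅).card := by
    calc _ ≤ (∑ p ∈ wires, ((R p).card : ℝ)) * b := by gcongr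
      _ = ∑ p ∈ wires, ((R p).card : ℝ) * b := Finset.sum_mul _ _ _
      _ ≤ ∑ p ∈ wires, ((coversContaining G ∅).card : ℝ) := Finset.sum_le_sum fun p _ => hRb p
      _ = _ := by rw [Finset.sum_const, hsize, nsmul_eq_mul]
  rw [mul_comm] at hfinal
  exact le_of_mul_le_mul_right hfinal hpos

end GraphCNF

/-- Substituting `s ≤ 3dn/2` gives `cLn/(4d²)`, which is at most `cLn/(3d)`; a factor of order `d`
and the `-1` are slack. -/
theorem exponent_mul_sub_one_le {c d L n s : ℝ} (hd : 3 ≤ d) (hc : 0 ≤ c) (hL : 0 ≤ L)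
    (hn : 0 ≤ n) (hs : 2 * s ≤ 3 * d * n) :
    c * L / (6 * d ^ 3) * s - 1 ≤ L * (c * n / (3 * d)) := by
  have hd0 : 0 < d := by linarith
  have hcL : 0 ≤ c * L := mul_nonneg hc hL
  have h1 : c * L / (6 * d ^ 3) * s ≤ c * L / (6 * d ^ 3) * (3 * d * n / 2) :=
    mul_le_mul_of_nonneg_left (by linarith) (by positivity)
  have h2 : c * L / (6 * d ^ 3) * (3 * d * n / 2) = c * L * n / (4 * d ^ 2) := by
    field_simp
    ring
  have h3 : c * L * n / (4 * d ^ 2) ≤ c * L * n / (3 * d) :=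
    div_le_div_of_nonneg_left (by positivity) (by positivity) (by nlinarith)
  have h4 : L * (c * n / (3 * d)) = c * L * n / (3 * d) := by ring
  linarith

theorem mainTheorem2 {X : Type u} (V : Finset X) (G : SimpleGraph V) (c : ℝ) (d : ℕ)
    (hV : 2 ≤ V.card) (hG : IsExpander G c d) :
    (2 : ℝ) ^ (expanderExponent c d * ((graphCNF G).size : ℝ) - 1) ≤
      ((graphCNF G).dnnfSize : ℝ) := by
  classical
  have hd3 := hG.three_le
  have hmax := hG.maxDegree_eq
  have hd : ∀ x, G.degree x ≤ d := fun x => by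
    rw [← hmax]
    convert G.degree_le_maxDegree x
  have : Nonempty V := (Finset.card_pos.1 (by omega : 0 < V.card)).to_subtype
  obtain ⟨x₀, hx₀⟩ := G.exists_maximal_degree_vertex
  have hdeg : G.degree x₀ = d := by
    rw [← hx₀, ← hmax]
  -- A vertex of degree `d ≥ 3` has three neighbours besides itself.
  have hV4 : 4 ≤ V.card := by
    have := G.degree_lt_card_verts x₀
    rw [Fintype.card_coe] at this
    omega
  have hbot : G ≠ ⊥ := by
    rintro rfl
    simp at hdeg
    omega
  obtain ⟨D₀, hD₀, hD₀G⟩ :=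
    exists_dnnf_equivalent_graphCNF (G := G) (Finset.card_pos.1 (by omega)) hbot
  obtain ⟨D, hD, hDG, hDs⟩ := Nat.sInf_mem
    (s := {s | ∃ D : NNF X, D.IsDecomposable ∧ D.Equivalent (graphCNF G) ∧ D.size = s})
    ⟨_, D₀, hD₀, hD₀G, rfl⟩
  rw [NNF.dnnfSize, ← hDs]
  refine le_trans ?_ (rpow_le_size_of_equivalent_graphCNF hV4 hG hd hbot hD hDG)
  have hpow : (0 : ℝ) < (2 : ℝ) ^ (-(d : ℝ)) := by positivity
  set L : ℝ := Real.logb 2 (1 + (2 : ℝ) ^ (-(d : ℝ))) with hL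
  have hL0 : 0 ≤ L := Real.logb_nonneg (by norm_num) (by linarith)
  have hbase : (1 + (2 : ℝ) ^ (-(d : ℝ))) = 2 ^ L :=
    (Real.rpow_logb (by norm_num) (by norm_num) (by linarith)).symm
  rw [hbase, ← Real.rpow_mul (by norm_num)]
  refine Real.rpow_le_rpow_of_exponent_le (by norm_num) ?_
  have hs : 2 * ((graphCNF G).size : ℝ) ≤ 3 * d * V.card := by
    exact_mod_cast two_mul_size_graphCNF_le G hd
  exact exponent_mul_sub_one_le (by exact_mod_cast hd3) hG.pos.le hL0 V.card.cast_nonneg hs
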